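/- An inversion sequence of length $n$ is an integer sequence $(a_1,\dots,a_n)$ with $0\le a_i<i$ for all $i$ (for $n=0$ there is exactly one, the empty sequence). Let $\mathcal I_n(-,-,>)$ be the set of inversion sequences of length $n$ for which there are no $i<j<k$ with $a_i>a_k$ (the relation $-$ imposes no condition), and for a set $S$ of patterns let $\mathcal I_n(S)$ be the set of inversion sequences of length $n$ that contain no subsequence, not necessarily consecutive, in the same relative order (including equalities) as some pattern in $S$. Then $\mathcal I_n(-,-,>)=\mathcal I_n(100,110,120,201,210)$ for all $n\ge 0$. There is exactly one formal power series $X=X(z)\in\mathbb Q[[z]]$ that satisfies $$1-X+z-zX+2zX^2-z^2X^3=0,$$ it begins $X=1+2z+5z^2+17z^3+64z^4+\cdots$, and the generating function $F(z)=\sum_{n\ge0}|\mathcal I_n(-,-,>)|\,z^n$ is given by $$F(z)=\frac{(1+z)(X-1)-z(1-z)X^2}{z(1+z)X}.$$ Moreover $F$ is algebraic over $\mathbb Q(z)$, and its minimal polynomial over $\mathbb Q(z)$, up to normalization by a nonzero element of $\mathbb Q(z)$, is $$-(z+1)F^3+4F^2-4F+1.$$ -/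

import Mathlib

/-- The inversion sequences of length `n`. Positions are indexed from `0`, so the condition
`0 ≤ a_i < i` for `i = 1, …, n` reads `a i < i + 1` for `i : Fin n`. -/
def invSeq (n : ℕ) : Set (Fin n → ℕ) :=
  {a | ∀ i : Fin n, a i < (i : ℕ) + 1}

theorem invSeq_finite (n : ℕ) : (invSeq n).Finite := by
  have h : (Set.pi Set.univ (fun i : Fin n => Set.Iio ((i : ℕ) + 1))).Finite :=
    Set.Finite.pi (fun i => Set.finite_Iio _)
  exact h.subset (fun a ha i _ => ha i)

/-- The relation `-`, which imposes no restriction. -/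
def noRel : ℕ → ℕ → Prop := fun _ _ => True

/-- `I_n(ρ₁, ρ₂, ρ₃)`: the inversion sequences of length `n` avoiding a triple of relations. -/
def invSeqAvoidRel (ρ₁ ρ₂ ρ₃ : ℕ → ℕ → Prop) (n : ℕ) : Set (Fin n → ℕ) :=
  {a | a ∈ invSeq n ∧
    ¬ ∃ i j k : Fin n, i < j ∧ j < k ∧ ρ₁ (a i) (a j) ∧ ρ₂ (a j) (a k) ∧ ρ₃ (a i) (a k)}

theorem invSeqAvoidRel_finite (ρ₁ ρ₂ ρ₃ : ℕ → ℕ → Prop) (n : ℕ) :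
    (invSeqAvoidRel ρ₁ ρ₂ ρ₃ n).Finite :=
  (invSeq_finite n).subset (fun _ ha => ha.1)

/-- The reduction of a word: the smallest entries become `0`, the next smallest `1`, and so on;
that is, each entry is replaced by the number of distinct smaller values in the word. -/
def reduction {k : ℕ} (w : Fin k → ℕ) : Fin k → ℕ :=
  fun i => ((Finset.univ.image w).filter (fun v => v < w i)).card

/-- `a` contains the pattern `σ`: some subsequence of `a` has reduction `σ`. -/
def containsPattern {n k : ℕ} (a : Fin n → ℕ) (σ : Fin k → ℕ) : Prop :=
  ∃ f : Fin k → Fin n, StrictMono f ∧ reduction (a ∘ f) = σ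

/-- `I_n(S)`: the inversion sequences of length `n` avoiding all patterns in `S`. -/
def invSeqAvoidPat {k : ℕ} (S : Set (Fin k → ℕ)) (n : ℕ) : Set (Fin n → ℕ) :=
  {a | a ∈ invSeq n ∧ ∀ σ ∈ S, ¬ containsPattern a σ}

/-- The generating function `∑ₙ |I_n(ρ₁, ρ₂, ρ₃)| zⁿ`, as a formal power series over `ℚ`. -/
noncomputable def invSeqGF (ρ₁ ρ₂ ρ₃ : ℕ → ℕ → Prop) : PowerSeries ℚ :=
  PowerSeries.mk (fun n => ((invSeqAvoidRel ρ₁ ρ₂ ρ₃ n).ncard : ℚ))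

/-- The kernel `1 - x + z - z x + 2 z x² - z² x³`, where `z` is the variable of the power series
ring and a power series is substituted for `x`. -/
noncomputable def kernel1420 (x : PowerSeries ℚ) : PowerSeries ℚ :=
  1 - x + PowerSeries.X - PowerSeries.X * x + 2 * PowerSeries.X * x ^ 2
    - PowerSeries.X ^ 2 * x ^ 3

/-- A formal power series over `ℚ`, viewed as an element of the field `ℚ((z))`, which is an
extension of the field `ℚ(z)` of rational functions. -/
noncomputable def toLaurent (f : PowerSeries ℚ) : LaurentSeries ℚ :=
  (f : LaurentSeries ℚ)

/-- The inclusion of `ℚ(z)` in `ℚ((z))`. This is Mathlib's instance, made available for this pair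
of fields only (as a scoped instance it would also apply to `ℚ(z)` over itself). -/
noncomputable instance ratFuncAlgebraLaurent : Algebra (RatFunc ℚ) (LaurentSeries ℚ) :=
  RatFunc.liftAlgebra ℚ (LaurentSeries ℚ)

theorem algebraMap_ratFunc_X :
    algebraMap (RatFunc ℚ) (LaurentSeries ℚ) RatFunc.X = toLaurent PowerSeries.X := by
  rw [toLaurent, HahnSeries.ofPowerSeries_X]
  exact RatFunc.coe_X

/-!
Read an avoiding sequence from left to right. If `p` and `q` are the maxima of all entries but the
last and of all entries, the next entry must be at least `p`, and then `(p, q)` becomes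
`(q, max q x)`. Up to translation the number of continuations depends only on the number `g` of
admissible values that are at least `q` and on `d = q - p`; after eliminating `d`, the generating
functions `c g` of the continuations satisfy
`c g - 2 c (g + 1) + (1 + z) c (g + 2) - z (1 + z) c (g + 3) = 0`, with `c 0 = 1` and `c 1 = F`.

Let `v` be the power series without constant term such that `v = z + v² + v³`. Then `u = v + v²` is
a root of the reciprocal characteristic polynomial. Since `c g` is a power series while `u⁻ᵍ` has
poles of unbounded order, the recurrence loses this root and becomes one of order two, whose first
instance is `F (1 - v) = 1`. The series `X` of the theorem is `u / z`, and substituting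
`v = 1 - 1 / F` in `z = v - v² - v³` gives the cubic of `F`. It is irreducible because a root of
`s³ + s² - s + z` in `ℚ(z)` would be a polynomial whose degree is a third of the degree of `z`.
-/

section Reduction

variable {k : ℕ} {w : Fin k → ℕ}

theorem reduction_lt_reduction_iff {i j : Fin k} : reduction w i < reduction w j ↔ w i < w j := by
  refine ⟨fun h => ?_, fun h => Finset.card_lt_card ?_⟩
  · contrapose! h
    exact Finset.card_le_card (Finset.monotone_filter_right _ fun v _ hv => hv.trans_le h)
  · refine (Finset.ssubset_iff_of_subset
      (Finset.monotone_filter_right _ fun v _ hv => hv.trans h)).mpr ⟨w i, ?_, ?_⟩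
    · simpa using h
    · simp

theorem reduction_le_reduction_of_lt_iff_lt {σ : Fin k → ℕ}
    (h : ∀ i j, w i < w j ↔ σ i < σ j) (i : Fin k) : reduction w i ≤ reduction σ i := by
  refine Finset.card_le_card_of_forall_subsingleton (fun x y => ∃ j, w j = x ∧ σ j = y) ?_ ?_
  · simp only [Finset.mem_filter, Finset.mem_image, Finset.mem_univ, true_and]
    rintro _ ⟨⟨j, rfl⟩, hj⟩
    exact ⟨σ j, ⟨⟨j, rfl⟩, (h j i).mp hj⟩, j, rfl, rfl⟩
  · rintro _ - _ ⟨-, j, rfl, rfl⟩ _ ⟨-, l, rfl, hl⟩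
    have hjl := h j l
    have hlj := h l j
    omega

theorem reduction_eq_of_lt_iff_lt {σ : Fin k → ℕ} (hσ : reduction σ = σ)
    (h : ∀ i j, w i < w j ↔ σ i < σ j) : reduction w = σ := by
  rw [← hσ]
  exact funext fun i => (reduction_le_reduction_of_lt_iff_lt h i).antisymm
    (reduction_le_reduction_of_lt_iff_lt (fun j l => (h j l).symm) i)

theorem reduction_eq_vec_three_of_lt_iff_lt {w : Fin 3 → ℕ} {x y z : ℕ}
    (hσ : reduction ![x, y, z] = ![x, y, z])
    (h : ((w 0 < w 1 ↔ x < y) ∧ (w 1 < w 0 ↔ y < x)) ∧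
      ((w 0 < w 2 ↔ x < z) ∧ (w 2 < w 0 ↔ z < x)) ∧
      ((w 1 < w 2 ↔ y < z) ∧ (w 2 < w 1 ↔ z < y))) :
    reduction w = ![x, y, z] :=
  reduction_eq_of_lt_iff_lt hσ fun i j => by fin_cases i <;> fin_cases j <;> simp [h]

theorem reduction_mem_iff_lt {w : Fin 3 → ℕ} :
    reduction w ∈ ({![1, 0, 0], ![1, 1, 0], ![1, 2, 0], ![2, 0, 1], ![2, 1, 0]} :
      Set (Fin 3 → ℕ)) ↔ w 2 < w 0 := by
  simp only [Set.mem_insert_iff, Set.mem_singleton_iff]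
  constructor
  · rintro (h | h | h | h | h) <;> exact reduction_lt_reduction_iff.mp (by simp [h])
  · intro h
    rcases lt_trichotomy (w 1) (w 2) with h12 | h12 | h12
    · exact .inr <| .inr <| .inr <| .inl <|
        reduction_eq_vec_three_of_lt_iff_lt (by decide) (by omega)
    · exact .inl <| reduction_eq_vec_three_of_lt_iff_lt (by decide) (by omega)
    rcases lt_trichotomy (w 0) (w 1) with h01 | h01 | h01
    · exact .inr <| .inr <| .inl <| reduction_eq_vec_three_of_lt_iff_lt (by decide) (by omega)
    · exact .inr <| .inl <| reduction_eq_vec_three_of_lt_iff_lt (by decide) (by omega)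
    · exact .inr <| .inr <| .inr <| .inr <|
        reduction_eq_vec_three_of_lt_iff_lt (by decide) (by omega)

theorem invSeqAvoidRel_eq_invSeqAvoidPat {ρ₁ ρ₂ ρ₃ : ℕ → ℕ → Prop} {S : Set (Fin 3 → ℕ)}
    (hS : ∀ w : Fin 3 → ℕ,
      reduction w ∈ S ↔ ρ₁ (w 0) (w 1) ∧ ρ₂ (w 1) (w 2) ∧ ρ₃ (w 0) (w 2)) (n : ℕ) :
    invSeqAvoidRel ρ₁ ρ₂ ρ₃ n = invSeqAvoidPat S n := by
  ext a
  refine and_congr_right fun _ => ⟨?_, ?_⟩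
  · rintro h _ hσ ⟨f, hf, rfl⟩
    exact h ⟨f 0, f 1, f 2, hf (by decide), hf (by decide), (hS (a ∘ f)).mp hσ⟩
  · rintro h ⟨i, j, k, hij, hjk, hρ⟩
    refine h _ ((hS (a ∘ ![i, j, k])).mpr hρ) ⟨![i, j, k], ?_, rfl⟩
    simpa [Fin.strictMono_iff_lt_succ, Fin.forall_fin_succ] using ⟨hij, hjk⟩

end Reduction

theorem ncard_eq_sum_ncard_cons_mem {α : Type*} {m : ℕ} {s : Set (Fin (m + 1) → α)}
    (hs : s.Finite) {t : Finset α} (ht : ∀ a ∈ s, a 0 ∈ t) :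
    s.ncard = ∑ x ∈ t, {c : Fin m → α | (Fin.cons x c : Fin (m + 1) → α) ∈ s}.ncard := by
  classical
  rw [Set.ncard_eq_toFinset_card s hs,
    Finset.card_eq_sum_card_fiberwise (f := fun a => a 0) (t := t) (by simpa using! ht)]
  refine Finset.sum_congr rfl fun x _ => ?_
  rw [← Set.ncard_coe_finset,
    ← Set.ncard_image_of_injective {c | _} (Fin.cons_right_injective (α := fun _ => α) x)]
  refine congrArg Set.ncard (Set.ext fun a => ?_)
  induction a using Fin.consCases with
  | _ y c =>
    simp only [Finset.coe_filter, Set.Finite.mem_toFinset, Set.mem_ofPred_eq, Fin.cons_zero,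
      Set.mem_image, Fin.cons_inj, exists_eq_right_right]
    exact ⟨fun ⟨h, hyx⟩ => ⟨hyx ▸ h, hyx.symm⟩, fun ⟨h, hxy⟩ => ⟨hxy ▸ h, hxy.symm⟩⟩

/-- The words of length `m` that can be appended to a sequence avoiding `(-, -, >)`, where `p` is
the maximum of all its entries but the last, `q` is the maximum of all its entries (maxima of empty
sets being `0`), and the appended entries are bounded by `L`, `L + 1`, … -/
def continuations (p q L m : ℕ) : Set (Fin m → ℕ) :=
  {c | (∀ i : Fin m, p ≤ c i ∧ c i < L + i) ∧ (∀ i : Fin m, 0 < (i : ℕ) → q ≤ c i) ∧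
    ∀ i k : Fin m, (i : ℕ) + 2 ≤ k → c i ≤ c k}

theorem invSeqAvoidRel_eq_continuations (n : ℕ) :
    invSeqAvoidRel noRel noRel (· > ·) n = continuations 0 0 1 n := by
  ext a
  simp only [invSeqAvoidRel, invSeq, continuations, noRel, Set.mem_ofPred_eq, true_and, zero_le,
    implies_true, add_comm 1]
  refine and_congr_right fun _ => ⟨fun h i k hik => ?_, ?_⟩
  · by_contra! hlt
    exact h ⟨i, ⟨i + 1, by omega⟩, k, Fin.lt_def.mpr (Nat.lt_succ_self _), Fin.lt_def.mpr hik, hlt⟩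
  · rintro h ⟨i, j, k, hij, hjk, hlt⟩
    exact hlt.not_ge (h i k (by rw [Fin.lt_def] at hij hjk; omega))

section Continuations

variable {p q L m : ℕ}

theorem continuations_finite (p q L m : ℕ) : (continuations p q L m).Finite :=
  (Set.Finite.pi' fun i : Fin m => Set.finite_Iio (L + i)).subset fun _ hc i => (hc.1 i).2

theorem cons_mem_continuations_iff (hpq : p ≤ q) {x : ℕ} {c : Fin m → ℕ} :
    (Fin.cons x c : Fin (m + 1) → ℕ) ∈ continuations p q L (m + 1) ↔
      x ∈ Finset.Ico p L ∧ c ∈ continuations q (max q x) (L + 1) m := by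
  simp only [continuations, Set.mem_ofPred_eq, Fin.forall_fin_succ, Fin.cons_zero, Fin.cons_succ,
    Fin.val_zero, Fin.val_succ, Finset.mem_Ico, add_zero, sup_le_iff]
  constructor
  · rintro ⟨⟨hx, hc⟩, ⟨-, hq⟩, ⟨-, hx'⟩, hcc⟩
    refine ⟨hx, fun i => ⟨hq i (by omega), ?_⟩, fun i hi => ⟨hq i (by omega), hx' i (by omega)⟩,
      fun i k hik => (hcc i).2 k (by omega)⟩
    have := (hc i).2
    omega
  · rintro ⟨hx, hc, hq, hcc⟩
    refine ⟨⟨hx, fun i => ⟨hpq.trans (hc i).1, ?_⟩⟩, ⟨by omega, fun i _ => (hc i).1⟩,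
      ⟨by omega, fun i hi => (hq i (by omega)).2⟩,
      fun i => ⟨by omega, fun k hik => hcc i k (by omega)⟩⟩
    have := (hc i).2
    omega

theorem ncard_continuations_succ (hpq : p ≤ q) :
    (continuations p q L (m + 1)).ncard =
      ∑ x ∈ Finset.Ico p L, (continuations q (max q x) (L + 1) m).ncard := by
  rw [ncard_eq_sum_ncard_cons_mem (continuations_finite p q L (m + 1)) (t := Finset.Ico p L)]
  · refine Finset.sum_congr rfl fun x hx => ?_
    simp only [cons_mem_continuations_iff hpq, hx, true_and, Set.ofPred_mem_eq]
  · intro a ha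
    rw [← Fin.cons_self_tail a, cons_mem_continuations_iff hpq] at ha
    exact ha.1

/-- The number of continuations of length `m` in terms of the number `g` of admissible values for
the next entry that are at least the current maximum `q`, and of `d = q - p`. An entry below `q` is
one of `d` values, all leading to `(g + 1, 0)`; the entry `q + i` leads to `(g + 1 - i, i)`. -/
def continuationCount : ℕ → ℕ → ℕ → ℕ
  | 0, _, _ => 1
  | m + 1, g, d => d * continuationCount m (g + 1) 0 +
      ∑ i ∈ Finset.range g, continuationCount m (g + 1 - i) i

theorem ncard_continuations {g d : ℕ} (hq : q = p + d) (hL : L = q + g) :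
    (continuations p q L m).ncard = continuationCount m g d := by
  induction m generalizing p q L g d with
  | zero =>
    rw [continuationCount, Set.ncard_eq_one]
    exact ⟨Fin.elim0, Set.eq_singleton_iff_unique_mem.mpr
      ⟨by simp [continuations], fun _ _ => Subsingleton.elim _ _⟩⟩
  | succ m ih =>
    have hbelow : ∀ x ∈ Finset.Ico p q, (continuations q (max q x) (L + 1) m).ncard =
        continuationCount m (g + 1) 0 := fun x hx => by
      rw [Finset.mem_Ico] at hx
      exact ih (by omega) (by omega)
    have habove : ∀ i ∈ Finset.range g, (continuations q (max q (q + i)) (L + 1) m).ncard =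
        continuationCount m (g + 1 - i) i := fun i hi => by
      rw [Finset.mem_range] at hi
      exact ih (by omega) (by omega)
    rw [ncard_continuations_succ (by omega), continuationCount,
      ← Finset.sum_Ico_consecutive _ (show p ≤ q by omega) (show q ≤ L by omega),
      Finset.sum_congr rfl hbelow, Finset.sum_Ico_eq_sum_range _ q L,
      show L - q = g by omega, Finset.sum_congr rfl habove, Finset.sum_const, Nat.card_Ico,
      smul_eq_mul, show q - p = d by omega]

end Continuations

section Series

open PowerSeries

/-- The generating function of `continuationCount` by the number of appended entries. -/
noncomputable def continuationSeries (g d : ℕ) : ℚ⟦X⟧ :=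
  mk fun m => (continuationCount m g d : ℚ)

theorem invSeqGF_eq_continuationSeries :
    invSeqGF noRel noRel (· > ·) = continuationSeries 1 0 := by
  ext n
  rw [invSeqGF, continuationSeries, coeff_mk, coeff_mk, invSeqAvoidRel_eq_continuations,
    ncard_continuations (d := 0) (g := 1) rfl rfl]

theorem continuationSeries_eq (g d : ℕ) :
    continuationSeries g d = 1 + X * ((d : ℚ⟦X⟧) * continuationSeries (g + 1) 0 +
      ∑ i ∈ Finset.range g, continuationSeries (g + 1 - i) i) := by
  ext m
  cases m with
  | zero => simp [continuationSeries, continuationCount]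
  | succ m =>
    rw [map_add, coeff_succ_X_mul, map_add, map_sum, coeff_one, if_neg m.succ_ne_zero, zero_add,
      ← nsmul_eq_mul, map_nsmul, nsmul_eq_mul]
    simp only [continuationSeries, coeff_mk, continuationCount, Nat.cast_add, Nat.cast_mul,
      Nat.cast_sum]

theorem continuationSeries_zero_zero : continuationSeries 0 0 = 1 := by
  simp [continuationSeries_eq 0 0]

theorem continuationSeries_succ_right (g d : ℕ) :
    continuationSeries g (d + 1) = continuationSeries g d + X * continuationSeries (g + 1) 0 := by
  rw [continuationSeries_eq g (d + 1), continuationSeries_eq g d]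
  push_cast
  ring

theorem continuationSeries_succ_sub (g : ℕ) :
    continuationSeries (g + 1) 0 - continuationSeries g 0 = X * (continuationSeries (g + 2) 0 +
      X * ∑ i ∈ Finset.range g, continuationSeries (g + 2 - i) 0) := by
  have hshift : ∀ i ∈ Finset.range g, continuationSeries (g + 1 + 1 - (i + 1)) (i + 1) =
      continuationSeries (g + 1 - i) i + X * continuationSeries (g + 2 - i) 0 := fun i hi => by
    rw [Finset.mem_range] at hi
    rw [Nat.add_sub_add_right, continuationSeries_succ_right, ← Nat.sub_add_comm (by omega)]
  rw [continuationSeries_eq (g + 1), continuationSeries_eq g, Finset.sum_range_succ',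
    Finset.sum_congr rfl hshift, Finset.sum_add_distrib, ← Finset.mul_sum]
  simp only [Nat.cast_zero, Nat.sub_zero]
  ring

theorem continuationSeries_recurrence (g : ℕ) :
    continuationSeries g 0 - 2 * continuationSeries (g + 1) 0
      + (1 + X) * continuationSeries (g + 2) 0
      - X * (1 + X) * continuationSeries (g + 3) 0 = 0 := by
  have hsucc := continuationSeries_succ_sub (g + 1)
  simp only [Finset.sum_range_succ', Nat.add_sub_add_right, Nat.sub_zero,
    Nat.add_right_comm g 1 2] at hsucc
  linear_combination hsucc - continuationSeries_succ_sub g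

section CommRing

variable {R : Type*} [CommRing R]

theorem eq_zero_of_forall_eq_mul_succ {u : R⟦X⟧} (hu : X ∣ u) {D : ℕ → R⟦X⟧}
    (hD : ∀ n, D n = u * D (n + 1)) (n : ℕ) : D n = 0 := by
  have hdvd : ∀ k n, X ^ k ∣ D n := fun k => by
    induction k with
    | zero => simp
    | succ k ih =>
      intro n
      rw [hD, pow_succ']
      exact mul_dvd_mul hu (ih (n + 1))
  ext k
  exact X_pow_dvd_iff.mp (hdvd (k + 1) n) k k.lt_succ_self

theorem order_two_recurrence_of_X_dvd_root {a b e u : R⟦X⟧} (hu : X ∣ u)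
    (hroot : u ^ 3 - e * u ^ 2 + b * u - a = 0) {c : ℕ → R⟦X⟧}
    (hc : ∀ n, c n - e * c (n + 1) + b * c (n + 2) - a * c (n + 3) = 0) (n : ℕ) :
    c n - (e - u) * c (n + 1) + (b - e * u + u ^ 2) * c (n + 2) = 0 :=
  eq_zero_of_forall_eq_mul_succ hu
    (D := fun n => c n - (e - u) * c (n + 1) + (b - e * u + u ^ 2) * c (n + 2))
    (fun n => by linear_combination hc n - c (n + 3) * hroot) n

theorem exists_X_dvd_eq_X_add_sq_add_cube : ∃ v : R⟦X⟧, X ∣ v ∧ v = X + v ^ 2 + v ^ 3 := by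
  nontriviality R
  let f : Polynomial R⟦X⟧ := .X ^ 3 + .X ^ 2 - .X + .C X
  obtain ⟨v, hroot, hv⟩ := HenselianRing.is_henselian (I := Ideal.span {(X : R⟦X⟧)}) f
    (by simp only [f]; monicity!) 0 (by simp [f]) (by simp [f])
  refine ⟨v, by simpa [Ideal.mem_span_singleton] using hv, ?_⟩
  have hfv : v ^ 3 + v ^ 2 - v + X = 0 := by simpa [f, Polynomial.IsRoot] using hroot
  linear_combination -hfv

theorem trunc_eq_of_X_pow_dvd_sub {f : R⟦X⟧} {p : Polynomial R} {n : ℕ} (hp : p.natDegree < n)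
    (h : X ^ n ∣ f - (p : R⟦X⟧)) : trunc n f = p := by
  obtain ⟨g, hg⟩ := h
  have htrunc := congrArg (trunc n) hg
  rwa [trunc_sub, trunc_coe_eq_self hp, trunc_X_pow_self_mul, sub_eq_zero] at htrunc

variable {v x F : R⟦X⟧}

theorem mul_X_mul_one_add_X_mul_eq (hv : v = X + v ^ 2 + v ^ 3) (hx : X * x = v + v ^ 2)
    (hF : F * (1 - v) = 1) :
    F * (X * (1 + X) * x) = (1 + X) * (x - 1) - X * (1 - X) * x ^ 2 := by
  refine X_mul_cancel ?_
  linear_combination (F * X * (1 + X) - (1 + X) + (1 - X) * (X * x + (v + v ^ 2))) * hx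
    + ((1 + X) * (v + v ^ 2 - X) - (1 - X) * (v + v ^ 2) ^ 2) * hF
    - F * ((1 + v ^ 2) * X + 1 - v ^ 2) * hv

theorem cubic_of_mul_one_sub_eq_one (hv : v = X + v ^ 2 + v ^ 3) (hF : F * (1 - v) = 1) :
    -(X + 1) * F ^ 3 + 4 * F ^ 2 - 4 * F + 1 = 0 := by
  linear_combination F ^ 3 * hv + (F ^ 2 - F * (F * v + (F - 1))
    - ((F * v) ^ 2 + F * v * (F - 1) + (F - 1) ^ 2)) * hF

end CommRing

variable {v x y : ℚ⟦X⟧}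

theorem invSeqGF_mul_one_sub (hXv : X ∣ v) (hv : v = X + v ^ 2 + v ^ 3) :
    invSeqGF noRel noRel (· > ·) * (1 - v) = 1 := by
  rw [invSeqGF_eq_continuationSeries]
  set F := continuationSeries 1 0
  have hXu : X ∣ v + v ^ 2 := hXv.add (hXv.trans (dvd_pow_self v two_ne_zero))
  have hroot : (v + v ^ 2) ^ 3 - 2 * (v + v ^ 2) ^ 2 + (1 + X) * (v + v ^ 2) - X * (1 + X) = 0 := by
    linear_combination (X + (1 - v - v ^ 2) * (1 + v)) * hv
  have hrec : 1 - (2 - (v + v ^ 2)) * F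
      + (1 + X - 2 * (v + v ^ 2) + (v + v ^ 2) ^ 2) * continuationSeries 2 0 = 0 := by
    simpa [continuationSeries_zero_zero] using order_two_recurrence_of_X_dvd_root hXu hroot
      (c := fun g => continuationSeries g 0) continuationSeries_recurrence 0
  have hF : F - 1 = X * continuationSeries 2 0 := by
    simpa [continuationSeries_zero_zero] using continuationSeries_succ_sub 0
  have hne : 1 - v - v ^ 2 ≠ 0 := fun h => by
    simpa [X_dvd_iff.mp hXv] using congrArg constantCoeff h
  refine mul_left_cancel₀ (pow_ne_zero 2 hne) ?_
  linear_combination X * hrec + (1 + X - 2 * (v + v ^ 2) + (v + v ^ 2) ^ 2) * hF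
    - F * (1 - v - v ^ 2) * hv

theorem kernel1420_eq_zero_of_X_mul_eq (hv : v = X + v ^ 2 + v ^ 3) (hx : X * x = v + v ^ 2) :
    kernel1420 x = 0 := by
  refine (mul_eq_zero_iff_left (X_ne_zero (R := ℚ))).mp ?_
  rw [kernel1420]
  linear_combination (-1 - X + 2 * (X * x + (v + v ^ 2))
    - ((X * x) ^ 2 + X * x * (v + v ^ 2) + (v + v ^ 2) ^ 2)) * hx
    - (X + (1 - v - v ^ 2) * (1 + v)) * hv

theorem associated_kernel1420_sub (x y : ℚ⟦X⟧) :
    Associated (kernel1420 x - kernel1420 y) (x - y) := by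
  have hunit : IsUnit (-1 + X * (-1 + 2 * (x + y) - X * (x ^ 2 + x * y + y ^ 2))) := by
    simp [isUnit_iff_constantCoeff]
  convert associated_mul_unit_left (x - y) _ hunit using 1
  simp only [kernel1420]
  ring

theorem eq_of_kernel1420_eq_zero (hx : kernel1420 x = 0) (hy : kernel1420 y = 0) : y = x := by
  have h := associated_kernel1420_sub y x
  rwa [hx, hy, sub_zero, Associated.comm, associated_zero_iff_eq_zero, sub_eq_zero] at h

theorem trunc_of_kernel1420_eq_zero (hx : kernel1420 x = 0) :
    trunc 5 x = (1 + 2 * Polynomial.X + 5 * Polynomial.X ^ 2 + 17 * Polynomial.X ^ 3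
      + 64 * Polynomial.X ^ 4 : Polynomial ℚ) := by
  refine trunc_eq_of_X_pow_dvd_sub (by compute_degree!) ?_
  rw [← (associated_kernel1420_sub _ _).dvd_iff_dvd_right, hx, zero_sub, dvd_neg]
  refine ⟨259 + 321 * X + 226 * X ^ 2 - 348 * X ^ 3 - 5185 * X ^ 4 - 34479 * X ^ 5
    - 62129 * X ^ 6 - 116928 * X ^ 7 - 208896 * X ^ 8 - 262144 * X ^ 9, ?_⟩
  have hcoe (k : ℕ) [k.AtLeastTwo] : ((OfNat.ofNat k : Polynomial ℚ) : ℚ⟦X⟧) = OfNat.ofNat k :=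
    map_ofNat (Polynomial.coeToPowerSeries.ringHom (R := ℚ)) k
  simp only [Polynomial.coe_add, Polynomial.coe_mul, Polynomial.coe_pow, Polynomial.coe_X,
    Polynomial.coe_one, hcoe, kernel1420]
  ring

end Series

section Cubic

open Polynomial

/-- The cubic annihilating the generating function `F`, over `K(z)` for an arbitrary field `K`. -/
noncomputable def gfCubic (K : Type*) [Field K] : (RatFunc K)[X] :=
  C (-(RatFunc.X + 1) : RatFunc K) * X ^ 3 + 4 * X ^ 2 - 4 * X + 1

variable (K : Type*) [Field K]

theorem ratFunc_monic_cubic_ne_zero (s : RatFunc K) : s ^ 3 + s ^ 2 - s + RatFunc.X ≠ 0 := by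
  intro hs
  have hmonic : (X ^ 3 + X ^ 2 - X + C X : K[X][X]).Monic := by monicity!
  obtain ⟨p, rfl⟩ := isInteger_of_is_root_of_monic hmonic
    (show aeval s (X ^ 3 + X ^ 2 - X + C X : K[X][X]) = 0 by simpa using hs)
  have hp : (X ^ 3 + X ^ 2 - X : K[X]).comp p = -X := by
    apply RatFunc.algebraMap_injective K
    simp only [sub_comp, add_comp, pow_comp, X_comp, map_sub, map_add, map_pow, map_neg,
      RatFunc.algebraMap_X]
    linear_combination hs
  have hdeg := congrArg natDegree hp
  rw [natDegree_comp, natDegree_neg, natDegree_X,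
    show (X ^ 3 + X ^ 2 - X : K[X]).natDegree = 3 by compute_degree!] at hdeg
  omega

theorem gfCubic_eq_cubic : gfCubic K =
    C (-(RatFunc.X + 1)) * X ^ 3 + C 4 * X ^ 2 + C (-4) * X + C 1 := by
  simp only [gfCubic, map_neg, map_one, map_ofNat]
  ring

theorem ratFunc_neg_X_add_one_ne_zero : (-(RatFunc.X + 1) : RatFunc K) ≠ 0 := by
  rw [neg_ne_zero, ← RatFunc.algebraMap_X, ← map_one (algebraMap K[X] (RatFunc K)), ← map_add]
  exact RatFunc.algebraMap_ne_zero (X_add_C_ne_zero 1)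

theorem leadingCoeff_gfCubic : (gfCubic K).leadingCoeff = -(RatFunc.X + 1) := by
  rw [gfCubic_eq_cubic, leadingCoeff_cubic (ratFunc_neg_X_add_one_ne_zero K)]

theorem irreducible_gfCubic : Irreducible (gfCubic K) := by
  refine irreducible_of_degree_le_three_of_not_isRoot ?_ fun r hr => ?_
  · rw [gfCubic_eq_cubic, natDegree_cubic (ratFunc_neg_X_add_one_ne_zero K)]
    decide
  · have hr' : -(RatFunc.X + 1) * r ^ 3 + 4 * r ^ 2 - 4 * r + 1 = 0 := by
      simpa [gfCubic] using hr
    have hr0 : r ≠ 0 := by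
      rintro rfl
      simp at hr'
    refine ratFunc_monic_cubic_ne_zero K (1 - r⁻¹) ?_
    field_simp
    linear_combination -hr'

theorem C_leadingCoeff_mul_minpoly {A B : Type*} [Field A] [Ring B] [IsDomain B] [Algebra A B]
    {P : A[X]} {b : B} (hP : Irreducible P) (hb : aeval b P = 0) :
    C P.leadingCoeff * minpoly A b = P := by
  rw [← minpoly.eq_of_irreducible hP hb, mul_comm, mul_assoc, ← C_mul,
    inv_mul_cancel₀ (leadingCoeff_ne_zero.mpr hP.ne_zero), C_1, mul_one]

end Cubic

section Laurent

open PowerSeries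

theorem aeval_toLaurent_gfCubic {F : ℚ⟦X⟧}
    (hF : -(X + 1) * F ^ 3 + 4 * F ^ 2 - 4 * F + 1 = 0) :
    Polynomial.aeval (toLaurent F) (gfCubic ℚ) = 0 := by
  have h := congrArg (HahnSeries.ofPowerSeries ℤ ℚ) hF
  simp only [map_add, map_sub, map_neg, map_mul, map_pow, map_one, map_ofNat, map_zero] at h
  simpa only [gfCubic, map_add, map_sub, map_neg, map_mul, map_pow, map_one, map_ofNat,
    Polynomial.aeval_X, Polynomial.aeval_C, algebraMap_ratFunc_X] using! h

theorem toLaurent_eq_div {f g h : ℚ⟦X⟧} (hh : h ≠ 0) (hfg : f * h = g) :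
    toLaurent f = toLaurent g / toLaurent h := by
  refine eq_div_of_mul_eq ?_ ?_
  · exact (map_ne_zero_iff _ HahnSeries.ofPowerSeries_injective).mpr hh
  · simp only [toLaurent, ← map_mul, hfg]

theorem toLaurent_eq_div_of_X_mul_eq {v x F : ℚ⟦X⟧} (hv : v = X + v ^ 2 + v ^ 3)
    (hx : X * x = v + v ^ 2) (hF : F * (1 - v) = 1) :
    toLaurent F =
      ((1 + toLaurent X) * (toLaurent x - 1)
          - toLaurent X * (1 - toLaurent X) * toLaurent x ^ 2) /
        (toLaurent X * (1 + toLaurent X) * toLaurent x) := by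
  have hx0 : x ≠ 0 := by
    rintro rfl
    simpa [kernel1420] using congrArg constantCoeff (kernel1420_eq_zero_of_X_mul_eq hv hx)
  have hX1 : (1 + X : ℚ⟦X⟧) ≠ 0 := fun h => by
    simpa using congrArg constantCoeff h
  simpa only [toLaurent, map_add, map_sub, map_mul, map_pow, map_one] using
    toLaurent_eq_div (mul_ne_zero (mul_ne_zero X_ne_zero hX1) hx0)
      (mul_X_mul_one_add_X_mul_eq hv hx hF)

end Laurent

theorem mainTheorem5 :
    -- equality of the two avoidance classes
    (∀ n : ℕ, invSeqAvoidRel noRel noRel (· > ·) n =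
      invSeqAvoidPat ({![1, 0, 0], ![1, 1, 0], ![1, 2, 0], ![2, 0, 1], ![2, 1, 0]} :
        Set (Fin 3 → ℕ)) n) ∧
    -- the unique power series root of the kernel and the generating function
    (∃ x : PowerSeries ℚ,
      kernel1420 x = 0 ∧
      (∀ y : PowerSeries ℚ, kernel1420 y = 0 → y = x) ∧
      PowerSeries.trunc 5 x =
        (1 + 2 * Polynomial.X + 5 * Polynomial.X ^ 2 + 17 * Polynomial.X ^ 3
          + 64 * Polynomial.X ^ 4 : Polynomial ℚ) ∧
      toLaurent (invSeqGF noRel noRel (· > ·)) =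
        ((1 + toLaurent PowerSeries.X) * (toLaurent x - 1)
            - toLaurent PowerSeries.X * (1 - toLaurent PowerSeries.X) * toLaurent x ^ 2) /
          (toLaurent PowerSeries.X * (1 + toLaurent PowerSeries.X) * toLaurent x)) ∧
    -- the minimal polynomial over `ℚ(z)` (`minpoly` is its monic normalization)
    (IsIntegral (RatFunc ℚ) (toLaurent (invSeqGF noRel noRel (· > ·))) ∧
      Polynomial.C (-(RatFunc.X + 1) : RatFunc ℚ) *
          minpoly (RatFunc ℚ) (toLaurent (invSeqGF noRel noRel (· > ·))) =
        Polynomial.C (-(RatFunc.X + 1) : RatFunc ℚ) * Polynomial.X ^ 3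
          + 4 * Polynomial.X ^ 2 - 4 * Polynomial.X + 1) := by
  obtain ⟨v, hXv, hv⟩ := exists_X_dvd_eq_X_add_sq_add_cube (R := ℚ)
  obtain ⟨x, hvx⟩ : PowerSeries.X ∣ v + v ^ 2 := hXv.add (hXv.trans (dvd_pow_self v two_ne_zero))
  have hx : kernel1420 x = 0 := kernel1420_eq_zero_of_X_mul_eq hv hvx.symm
  have hF := invSeqGF_mul_one_sub hXv hv
  have hroot := aeval_toLaurent_gfCubic (cubic_of_mul_one_sub_eq_one hv hF)
  have hirr := irreducible_gfCubic ℚ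
  have hmin := C_leadingCoeff_mul_minpoly hirr hroot
  rw [leadingCoeff_gfCubic, gfCubic] at hmin
  exact ⟨invSeqAvoidRel_eq_invSeqAvoidPat fun w => by simpa [noRel] using reduction_mem_iff_lt,
    ⟨x, hx, fun y hy => eq_of_kernel1420_eq_zero hx hy, trunc_of_kernel1420_eq_zero hx,
      toLaurent_eq_div_of_X_mul_eq hv hvx.symm hF⟩,
    IsAlgebraic.isIntegral ⟨gfCubic ℚ, hirr.ne_zero, hroot⟩, hmin⟩
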